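/- Let $X$ and $U$ be Banach spaces over $\mathbb K\in\{\mathbb R,\mathbb C\}$, let $A$ generate a $C_0$-semigroup $(T(t))_{t\ge0}$ on $X$, and let $X_{-1}$ be the completion of $X$ with respect to the norm $\|(\lambda-A)^{-1}x\|_X$ for some $\lambda\in\rho(A)$. Let $(T_{-1}(t))_{t\ge0}$ be the continuous extension of $(T(t))_{t\ge0}$ to $X_{-1}$, and let $B:U\to X_{-1}$ be a bounded linear operator. The system $\Sigma(A,B)$ is $\dot x=Ax+Bu$, $x(0)=x_0$, with mild solution $$x(t)=T(t)x_0+\int_0^tT_{-1}(t-s)Bu(s)\,ds\in X_{-1},\qquad t\ge0 .$$ Let $\mathcal K$ be the set of continuous, strictly increasing $\mu:[0,\infty)\to[0,\infty)$ with $\mu(0)=0$, let $\mathcal K_\infty$ be the set of $\mu\in\mathcal K$ with $\mu(r)\to\infty$ as $r\to\infty$, and let $\mathcal{KL}$ be the set of $\beta:[0,\infty)^2\to[0,\infty)$ such that $\beta(\cdot,t)\in\mathcal K$ for all $t\ge0$ and, for all $r>0$, $\beta(r,\cdot)$ is continuous and strictly decreasing with limit $0$ at $\infty$. The system $\Sigma(A,B)$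 is called * $L^\infty$-ISS if there are $\beta\in\mathcal{KL}$ and $\mu\in\mathcal K_\infty$ such that for all $t\ge0$, $x_0\in X$ and $u\in L^\infty(0,t;U)$ one has $x(t)\in X$ and $\|x(t)\|_X\le\beta(\|x_0\|,t)+\mu(\|u\|_{L^\infty(0,t;U)})$; * $L^\infty$-iISS if there are $\beta\in\mathcal{KL}$, $\theta\in\mathcal K_\infty$ and $\mu\in\mathcal K$ such that for all $t\ge0$, $x_0\in X$ and $u\in L^\infty(0,t;U)$ one has $x(t)\in X$ and $\|x(t)\|_X\le\beta(\|x_0\|,t)+\theta\big(\int_0^t\mu(\|u(s)\|_U)\,ds\big)$. A Young function is a function $\Phi(t)=\int_0^t\varphi(s)\,ds$, $t\ge0$, where $\varphi:[0,\infty)\to\mathbb R$ is right-continuous and nondecreasing with $\varphi(0)=0$, $\varphi(s)>0$ for $s>0$, and $\lim_{s\to\infty}\varphi(s)=\infty$. **Proposition.** Let $\Sigma(A,B)$ be $L^\infty$-ISS. Suppose that there exist a nonnegative function $f\in L^1(0,1)$, $\theta\in\mathcal K$, a constant $c>0$ and a Young function $\mu$ such that for every $u\in L^1(0,1;U)$ with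 $\int_0^1f(s)\mu(\|u(s)\|_U)\,ds<\infty$ one has $\int_0^1T_{-1}(s)Bu(s)\,ds\in X$ and $$\left\|\int_0^1T_{-1}(s)Bu(s)\,ds\right\|_X\le c+\theta\left(\int_0^1f(s)\mu(\|u(s)\|_U)\,ds\right).$$ Then $\Sigma(A,B)$ is $L^\infty$-iISS. -/

import Mathlib

open MeasureTheory Filter Topology Set
open scoped ENNReal NNReal

noncomputable section

/-- A `C₀`-semigroup `(T(t))_{t ≥ 0}` of bounded operators on `X`. -/
structure C0Semigroup (𝕜 X : Type*) [RCLike 𝕜] [NormedAddCommGroup X] [NormedSpace 𝕜 X] where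
  /-- the operator `T(t)` -/
  op : ℝ≥0 → X →L[𝕜] X
  op_zero : op 0 = ContinuousLinearMap.id 𝕜 X
  op_add : ∀ s t : ℝ≥0, op (s + t) = (op s).comp (op t)
  continuous_orbit : ∀ x : X, Continuous fun t : ℝ≥0 => op t x

namespace C0Semigroup

variable {𝕜 X : Type*} [RCLike 𝕜] [NormedAddCommGroup X] [NormedSpace 𝕜 X]

/-- `y = lim_{h ↓ 0} (T(h) x - x) / h`, i.e. `x ∈ D(A)` and `A x = y`. -/
def IsRightDerivAtZero (T : C0Semigroup 𝕜 X) (x y : X) : Prop :=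
  Tendsto (fun h : ℝ≥0 => (((h : ℝ) : 𝕜))⁻¹ • (T.op h x - x)) (𝓝[>] 0) (𝓝 y)

theorem IsRightDerivAtZero.unique {T : C0Semigroup 𝕜 X} {x y z : X}
    (hy : T.IsRightDerivAtZero x y) (hz : T.IsRightDerivAtZero x z) : y = z :=
  tendsto_nhds_unique hy hz

theorem IsRightDerivAtZero.add {T : C0Semigroup 𝕜 X} {x y x' y' : X}
    (h : T.IsRightDerivAtZero x y) (h' : T.IsRightDerivAtZero x' y') :
    T.IsRightDerivAtZero (x + x') (y + y') := by
  refine (Tendsto.add h h').congr fun s => ?_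
  rw [← smul_add, map_add]
  congr 1
  abel

theorem IsRightDerivAtZero.smul {T : C0Semigroup 𝕜 X} {x y : X} (c : 𝕜)
    (h : T.IsRightDerivAtZero x y) : T.IsRightDerivAtZero (c • x) (c • y) := by
  refine (Tendsto.const_smul h c).congr fun s => ?_
  rw [smul_comm c, map_smul, smul_sub]

theorem IsRightDerivAtZero.zero (T : C0Semigroup 𝕜 X) : T.IsRightDerivAtZero 0 0 := by
  simp [IsRightDerivAtZero]

theorem IsRightDerivAtZero.op {T : C0Semigroup 𝕜 X} {x y : X} (t : ℝ≥0)
    (h : T.IsRightDerivAtZero x y) : T.IsRightDerivAtZero (T.op t x) (T.op t y) := by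
  refine (((T.op t).continuous.tendsto y).comp h).congr fun s => ?_
  have h1 : T.op t (T.op s x) = T.op s (T.op t x) := by
    have := T.op_add t s
    rw [add_comm, T.op_add s t] at this
    exact (congrArg (fun L : X →L[𝕜] X => L x) this).symm
  simp only [Function.comp_apply, map_smul, map_sub, h1]

/-- The (infinitesimal) generator `A : D(A) ⊆ X → X` of the semigroup. -/
def generator (T : C0Semigroup 𝕜 X) : X →ₗ.[𝕜] X where
  domain :=
    { carrier := {x | ∃ y, T.IsRightDerivAtZero x y}
      add_mem' := fun ⟨y, hy⟩ ⟨y', hy'⟩ => ⟨y + y', hy.add hy'⟩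
      zero_mem' := ⟨0, IsRightDerivAtZero.zero T⟩
      smul_mem' := fun c _ ⟨y, hy⟩ => ⟨c • y, hy.smul c⟩ }
  toFun :=
    { toFun := fun x => x.2.choose
      map_add' := fun x x' =>
        (x + x').2.choose_spec.unique (x.2.choose_spec.add x'.2.choose_spec)
      map_smul' := fun c x => (c • x).2.choose_spec.unique (x.2.choose_spec.smul c) }

theorem generator_spec (T : C0Semigroup 𝕜 X) (x : T.generator.domain) :
    T.IsRightDerivAtZero (x : X) (T.generator x) := x.2.choose_spec

/-- `R` is the bounded inverse of `lam - A : D(A) → X`. -/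
def IsResolventAt (T : C0Semigroup 𝕜 X) (lam : 𝕜) (R : X →L[𝕜] X) : Prop :=
  (∀ x : T.generator.domain, R (lam • (x : X) - T.generator x) = x) ∧
    ∀ y : X, ∃ h : R y ∈ T.generator.domain, lam • R y - T.generator ⟨R y, h⟩ = y

/-- The resolvent set `ρ(A)` of the generator `A`. -/
def resolventSet (T : C0Semigroup 𝕜 X) : Set 𝕜 := {lam | ∃ R, T.IsResolventAt lam R}

/-- The resolvent `(lam - A)⁻¹`, `lam ∈ ρ(A)`. -/
def resolvent (T : C0Semigroup 𝕜 X) (lam : T.resolventSet) : X →L[𝕜] X := lam.2.choose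

theorem resolvent_spec (T : C0Semigroup 𝕜 X) (lam : T.resolventSet) :
    T.IsResolventAt (lam : 𝕜) (T.resolvent lam) := lam.2.choose_spec

theorem resolvent_injective (T : C0Semigroup 𝕜 X) (lam : T.resolventSet) :
    Function.Injective (T.resolvent lam) := by
  intro x y hxy
  obtain ⟨hx, hx'⟩ := (T.resolvent_spec lam).2 x
  obtain ⟨hy, hy'⟩ := (T.resolvent_spec lam).2 y
  rw [← hx', ← hy']
  have : (⟨_, hx⟩ : T.generator.domain) = ⟨_, hy⟩ := Subtype.ext hxy
  rw [this, hxy]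

theorem resolvent_op (T : C0Semigroup 𝕜 X) (lam : T.resolventSet) (t : ℝ≥0) (x : X) :
    T.resolvent lam (T.op t x) = T.op t (T.resolvent lam x) := by
  obtain ⟨hx, hx'⟩ := (T.resolvent_spec lam).2 x
  have h1 := (T.generator_spec ⟨_, hx⟩).op t
  have hmem : T.op t (T.resolvent lam x) ∈ T.generator.domain := ⟨_, h1⟩
  have h2 : T.generator ⟨_, hmem⟩ = T.op t (T.generator ⟨_, hx⟩) :=
    (T.generator_spec ⟨_, hmem⟩).unique h1
  have h3 := (T.resolvent_spec lam).1 ⟨_, hmem⟩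
  rw [h2] at h3
  refine Eq.trans ?_ h3
  congr 1
  conv_lhs => rw [← hx']
  rw [map_sub, map_smul]

/-- The vector space `X`, to be normed by `x ↦ ‖(lam - A)⁻¹ x‖`. -/
def PreExtrap (T : C0Semigroup 𝕜 X) (_lam : T.resolventSet) : Type _ := X

instance (T : C0Semigroup 𝕜 X) (lam : T.resolventSet) : AddCommGroup (T.PreExtrap lam) :=
  inferInstanceAs (AddCommGroup X)

instance (T : C0Semigroup 𝕜 X) (lam : T.resolventSet) : Module 𝕜 (T.PreExtrap lam) :=
  inferInstanceAs (Module 𝕜 X)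

/-- The identity map from `X` to its renormed copy. -/
def toPreExtrap (T : C0Semigroup 𝕜 X) (lam : T.resolventSet) : X ≃ₗ[𝕜] T.PreExtrap lam :=
  LinearEquiv.refl 𝕜 X

/-- The resolvent as a linear map out of `PreExtrap`; it induces the norm there. -/
def preExtrapResolvent (T : C0Semigroup 𝕜 X) (lam : T.resolventSet) : T.PreExtrap lam →ₗ[𝕜] X :=
  (T.resolvent lam).toLinearMap ∘ₗ (T.toPreExtrap lam).symm.toLinearMap

theorem preExtrapResolvent_injective (T : C0Semigroup 𝕜 X) (lam : T.resolventSet) :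
    Function.Injective (T.preExtrapResolvent lam) :=
  (T.resolvent_injective lam).comp (T.toPreExtrap lam).symm.injective

instance (T : C0Semigroup 𝕜 X) (lam : T.resolventSet) : NormedAddCommGroup (T.PreExtrap lam) :=
  NormedAddCommGroup.induced _ X (T.preExtrapResolvent lam) (T.preExtrapResolvent_injective lam)

instance (T : C0Semigroup 𝕜 X) (lam : T.resolventSet) : NormedSpace 𝕜 (T.PreExtrap lam) :=
  NormedSpace.induced 𝕜 (T.PreExtrap lam) X (T.preExtrapResolvent lam)

/-- The extrapolation space `X₋₁`: the completion of `X` with respect to the norm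
`‖(lam - A)⁻¹ x‖`. -/
abbrev Extrap (T : C0Semigroup 𝕜 X) (lam : T.resolventSet) : Type _ :=
  UniformSpace.Completion (T.PreExtrap lam)

/-- The real structure of `X₋₁`, needed for Bochner integrals in `X₋₁`. -/
instance instNormedSpaceRealExtrap (T : C0Semigroup 𝕜 X) (lam : T.resolventSet) :
    NormedSpace ℝ (T.Extrap lam) :=
  NormedSpace.restrictScalars ℝ 𝕜 (T.Extrap lam)

/-- The canonical embedding `X → X₋₁`. -/
def toExtrap (T : C0Semigroup 𝕜 X) (lam : T.resolventSet) : X →ₗ[𝕜] T.Extrap lam :=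
  (UniformSpace.Completion.toComplL : T.PreExtrap lam →L[𝕜] T.Extrap lam).toLinearMap ∘ₗ
    (T.toPreExtrap lam).toLinearMap

theorem norm_toExtrap (T : C0Semigroup 𝕜 X) (lam : T.resolventSet) (x : X) :
    ‖T.toExtrap lam x‖ = ‖T.resolvent lam x‖ :=
  UniformSpace.Completion.norm_coe (T.toPreExtrap lam x)

theorem toExtrap_injective (T : C0Semigroup 𝕜 X) (lam : T.resolventSet) :
    Function.Injective (T.toExtrap lam) :=
  (UniformSpace.Completion.coe_injective (T.PreExtrap lam)).comp (T.toPreExtrap lam).injective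

/-- `T(t)`, as a bounded operator for the norm `‖(lam - A)⁻¹ x‖`. -/
def preExtrapOp (T : C0Semigroup 𝕜 X) (lam : T.resolventSet) (t : ℝ≥0) :
    T.PreExtrap lam →L[𝕜] T.PreExtrap lam :=
  LinearMap.mkContinuous
    ((T.toPreExtrap lam).toLinearMap ∘ₗ (T.op t).toLinearMap ∘ₗ
      (T.toPreExtrap lam).symm.toLinearMap) ‖T.op t‖ fun x => by
    have h := (T.op t).le_opNorm (T.resolvent lam ((T.toPreExtrap lam).symm x))
    rw [← resolvent_op] at h
    exact h

/-- The operator `T₋₁(t)` on `X₋₁`: the continuous extension of `T(t)`. -/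
def extrapOp (T : C0Semigroup 𝕜 X) (lam : T.resolventSet) (t : ℝ≥0) :
    T.Extrap lam →L[𝕜] T.Extrap lam :=
  (T.preExtrapOp lam t).completion

theorem extrapOp_toExtrap (T : C0Semigroup 𝕜 X) (lam : T.resolventSet) (t : ℝ≥0) (x : X) :
    T.extrapOp lam t (T.toExtrap lam x) = T.toExtrap lam (T.op t x) :=
  UniformSpace.Completion.map_coe (T.preExtrapOp lam t).uniformContinuous (T.toPreExtrap lam x)

end C0Semigroup

/-! Comparison functions on `[0, ∞)`, represented by functions on `ℝ` of which only the values
at nonnegative arguments matter. -/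

/-- The class `𝒦`. -/
def IsClassK (f : ℝ → ℝ) : Prop :=
  f 0 = 0 ∧ ContinuousOn f (Ici 0) ∧ StrictMonoOn f (Ici 0)

/-- The class `𝒦_∞`. -/
def IsClassKInfty (f : ℝ → ℝ) : Prop := IsClassK f ∧ Tendsto f atTop atTop

/-- The class `ℒ` (nonnegativity follows from the monotonicity and the limit). -/
def IsClassL (f : ℝ → ℝ) : Prop :=
  ContinuousOn f (Ici 0) ∧ StrictAntiOn f (Ici 0) ∧ Tendsto f atTop (𝓝 0)

/-- The class `𝒦ℒ`. -/
def IsClassKL (β : ℝ → ℝ → ℝ) : Prop :=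
  (∀ t, 0 ≤ t → IsClassK fun s => β s t) ∧ ∀ s, 0 < s → IsClassL (β s)

/-- Young functions `Φ : [0, ∞) → ℝ`: those generated by some right-continuous nondecreasing `φ`
with `φ(0) = 0`, `φ > 0` on `(0, ∞)` and `φ(s) → ∞` as `s → ∞`. -/
def IsYoungFunction (Φ : ℝ → ℝ) : Prop :=
  ∃ φ : ℝ → ℝ, (∀ s, 0 ≤ s → ContinuousWithinAt φ (Ici s) s) ∧ MonotoneOn φ (Ici 0) ∧
    φ 0 = 0 ∧ (∀ s, 0 < s → 0 < φ s) ∧ Tendsto φ atTop atTop ∧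
    ∀ t, 0 ≤ t → Φ t = ∫ s in (0 : ℝ)..t, φ s

section System

variable {𝕜 X U : Type*} [RCLike 𝕜] [NormedAddCommGroup X] [NormedSpace 𝕜 X]
  [NormedAddCommGroup U] [NormedSpace 𝕜 U]

/-- `u ∈ L^p(0,t;U)`; only the values of `u` on `(0,t)` matter. -/
def IsLpInput (p : ℝ≥0∞) (t : ℝ) (u : ℝ → U) : Prop := MemLp u p (volume.restrict (Ioo 0 t))

/-- The norm of `L^∞(0,t;U)`. -/
def linftyNorm (t : ℝ) (u : ℝ → U) : ℝ := (eLpNorm u ∞ (volume.restrict (Ioo 0 t))).toReal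

/-- The mild solution `x(t) = T(t) x₀ + ∫₀ᵗ T₋₁(t-s) B u(s) ds ∈ X₋₁` of
`x' = A x + B u`, `x(0) = x₀`, where `A` is the generator of `T`. -/
def mildSolution (T : C0Semigroup 𝕜 X) (lam : T.resolventSet) (B : U →L[𝕜] T.Extrap lam)
    (x₀ : X) (u : ℝ → U) (t : ℝ≥0) : T.Extrap lam :=
  T.toExtrap lam (T.op t x₀) +
    ∫ s in (0 : ℝ)..t, T.extrapOp lam ((t : ℝ) - s).toNNReal (B (u s))

/-- `Σ(A,B)` is `L^∞`-ISS. -/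
def IsLinftyISS (T : C0Semigroup 𝕜 X) (lam : T.resolventSet) (B : U →L[𝕜] T.Extrap lam) : Prop :=
  ∃ (β : ℝ → ℝ → ℝ) (μ : ℝ → ℝ), IsClassKL β ∧ IsClassKInfty μ ∧
    ∀ (t : ℝ≥0) (x₀ : X) (u : ℝ → U), IsLpInput ∞ t u →
      ∃ x : X, T.toExtrap lam x = mildSolution T lam B x₀ u t ∧
        ‖x‖ ≤ β ‖x₀‖ t + μ (linftyNorm t u)

/-- `Σ(A,B)` is `L^∞`-iISS. -/
def IsLinftyIISS (T : C0Semigroup 𝕜 X) (lam : T.resolventSet) (B : U →L[𝕜] T.Extrap lam) : Prop :=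
  ∃ (β : ℝ → ℝ → ℝ) (θ μ : ℝ → ℝ), IsClassKL β ∧ IsClassKInfty θ ∧ IsClassK μ ∧
    ∀ (t : ℝ≥0) (x₀ : X) (u : ℝ → U), IsLpInput ∞ t u →
      ∃ x : X, T.toExtrap lam x = mildSolution T lam B x₀ u t ∧
        ‖x‖ ≤ β ‖x₀‖ t + θ (∫ s in (0 : ℝ)..t, μ ‖u s‖)

end System

end

/-! Write `Ψ u` for the unit-time integral of `T₋₁(s) B u(s)`. Applying the hypothesis to `k u` and
dividing by `k` gives `‖Ψ u‖ ≤ (c + θ(∫ f μ(k‖u‖))) / k`, so the constant `c` becomes harmless for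
large `k`, provided that `∫ f μ(k‖u‖)` is controlled for every `k` by one unweighted integral `∫
C(‖u‖)`.

Such a `C`, independent of `k`, comes from `exists_isClassKInfty_mul_le_add`: `f(s) μ(k r) ≤ F_k(s)
+ C(r)` with `F_k` integrable. Absolute continuity of the integral of `F_k` then makes `∫ f μ(k‖u‖)
≤ 1` once `∫ C(‖u‖)` is small (`exists_isClassKInfty_integral_bounds`). Hence the largest `‖Ψ u‖`
subject to `∫ C(‖u‖) ≤ a` is finite and tends to `0` with `a`, which yields a gain `η`
(`exists_unit_time_gain`).

For arbitrary times, the time-reversed input is cut into unit intervals. Each contributes `T(n) x_n`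
with `‖x_n‖ ≤ η(∫ C(‖u‖))`, and `∑ ‖T(n)‖` is bounded because ISS with zero input forces `‖T(t)‖ →
0`. -/

/-! ### Majorants in class `𝒦_∞` and properties of Young functions -/

theorem IsClassK.nonneg {g : ℝ → ℝ} (hg : IsClassK g) {r : ℝ} (hr : 0 ≤ r) : 0 ≤ g r :=
  hg.1 ▸ hg.2.2.monotoneOn self_mem_Ici hr hr

/-- The average of `h` over `[a, 2a]` dominates `h a`, is monotone, and is continuous even if `h`
jumps. Adding `a` makes it strictly increasing and unbounded. -/
theorem exists_isClassKInfty_ge {h : ℝ → ℝ} (hmono : MonotoneOn h (Ici 0))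
    (hnn : ∀ a, 0 ≤ a → 0 ≤ h a)
    (hlim : ∀ ε > 0, ∃ δ > 0, ∀ a, 0 ≤ a → a ≤ δ → h a ≤ ε) :
    ∃ θ : ℝ → ℝ, IsClassKInfty θ ∧ ∀ a, 0 ≤ a → h a ≤ θ a := by
  set g : ℝ → ℝ := fun a => h (max a 0) with hg
  have gm : Monotone g := fun a b hab =>
    hmono (mem_Ici.2 (le_max_right _ _)) (mem_Ici.2 (le_max_right _ _)) (max_le_max_right 0 hab)
  have gnn : ∀ a, 0 ≤ g a := fun a => hnn _ (le_max_right _ _)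
  have geq : ∀ a, 0 ≤ a → g a = h a := fun a ha => by simp [hg, ha]
  have gii : ∀ a b, IntervalIntegrable g volume a b := fun a b => gm.intervalIntegrable
  have gmul : ∀ a, 0 ≤ a → Monotone fun s => g (a * s) := fun a ha s t hst =>
    gm (mul_le_mul_of_nonneg_left hst ha)
  have hlow : ∀ a, 0 ≤ a → g a ≤ ∫ s in (1 : ℝ)..2, g (a * s) := by
    intro a ha
    have := intervalIntegral.integral_mono_on (a := 1) (b := 2) (μ := volume)
      (f := fun _ => g a) (g := fun s => g (a * s)) (by norm_num) (by simp)
      (gmul a ha).intervalIntegrable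
      (fun s hs => gm (le_mul_of_one_le_right ha hs.1))
    simp only [intervalIntegral.integral_const, smul_eq_mul] at this
    linarith
  have hup : ∀ a, 0 ≤ a → ∫ s in (1 : ℝ)..2, g (a * s) ≤ g (a * 2) := by
    intro a ha
    have := intervalIntegral.integral_mono_on (a := 1) (b := 2) (μ := volume)
      (f := fun s => g (a * s)) (g := fun _ => g (a * 2)) (by norm_num)
      (gmul a ha).intervalIntegrable (by simp)
      (fun s hs => gm (mul_le_mul_of_nonneg_left hs.2 ha))
    simp only [intervalIntegral.integral_const, smul_eq_mul] at this
    linarith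
  have hmonoI : ∀ a b, 0 ≤ a → a ≤ b →
      ∫ s in (1 : ℝ)..2, g (a * s) ≤ ∫ s in (1 : ℝ)..2, g (b * s) := fun a b ha hab =>
    intervalIntegral.integral_mono_on (by norm_num) (gmul a ha).intervalIntegrable
      (gmul b (ha.trans hab)).intervalIntegrable
      (fun s hs => gm (mul_le_mul_of_nonneg_right hab (by linarith [hs.1])))
  have g0 : g 0 = 0 := by
    refine le_antisymm (le_of_forall_pos_le_add fun ε hε => ?_) (gnn 0)
    obtain ⟨δ, hδ, hh⟩ := hlim ε hε
    simpa [geq 0 le_rfl] using hh 0 le_rfl hδ.le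
  have hI0 : ∫ s in (1 : ℝ)..2, g (0 * s) = 0 := by simp [g0]
  refine ⟨fun a => a + ∫ s in (1 : ℝ)..2, g (a * s), ⟨⟨by simp [g0], ?_, ?_⟩, ?_⟩, ?_⟩
  · refine continuousOn_id.add fun a ha => ?_
    rcases (mem_Ici.1 ha).eq_or_lt with rfl | hpos
    · rw [ContinuousWithinAt, hI0, Metric.tendsto_nhdsWithin_nhds]
      intro ε hε
      obtain ⟨δ, hδ, hh⟩ := hlim (ε / 2) (by positivity)
      refine ⟨δ / 2, by positivity, fun {a} ha hd => ?_⟩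
      have ha : 0 ≤ a := ha
      rw [Real.dist_eq, sub_zero, abs_of_nonneg ha] at hd
      rw [Real.dist_eq, sub_zero, abs_of_nonneg ((gnn a).trans (hlow a ha))]
      have := hup a ha
      rw [geq _ (by positivity)] at this
      have := hh (a * 2) (by positivity) (by linarith)
      linarith
    · refine ContinuousAt.continuousWithinAt ?_
      have hc : Continuous fun x => ∫ s in (0 : ℝ)..x, g s :=
        intervalIntegral.continuous_primitive gii 0
      -- Away from `0` the average is `a⁻¹ ∫ g` over `[a, 2a]`, a difference of primitives divided
      -- by `a`.
      have h2 : ContinuousAt (fun x : ℝ => x⁻¹ * ((∫ s in (0 : ℝ)..x * 2, g s) -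
          ∫ s in (0 : ℝ)..x, g s)) a :=
        (continuousAt_inv₀ hpos.ne').mul
          ((hc.comp (continuous_id.mul continuous_const)).sub hc).continuousAt
      refine h2.congr ?_
      filter_upwards [lt_mem_nhds hpos] with x hx
      rw [intervalIntegral.integral_comp_mul_left _ hx.ne',
        intervalIntegral.integral_interval_sub_left (gii _ _) (gii _ _)]
      simp
  · intro a ha b hb hab
    exact add_lt_add_of_lt_of_le hab (hmonoI a b ha hab.le)
  · refine tendsto_atTop_mono' _ ?_ tendsto_id
    filter_upwards [eventually_ge_atTop 0] with a ha
    have := (gnn a).trans (hlow a ha)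
    simp only [id]
    linarith
  · intro a ha
    have := hlow a ha
    rw [geq a ha] at this
    simp only
    linarith

theorem IsYoungFunction.zero {Φ : ℝ → ℝ} (h : IsYoungFunction Φ) : Φ 0 = 0 := by
  obtain ⟨φ, -, -, -, -, -, h⟩ := h
  simpa using h 0 le_rfl

theorem IsYoungFunction.exists_monotone {Φ : ℝ → ℝ} (h : IsYoungFunction Φ) :
    ∃ φ : ℝ → ℝ, Monotone φ ∧ (∀ s, 0 ≤ φ s) ∧ ∀ t, 0 ≤ t → Φ t = ∫ s in (0 : ℝ)..t, φ s := by
  obtain ⟨φ, -, hm, h0, -, -, h⟩ := h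
  refine ⟨fun s => φ (max s 0), fun a b hab =>
    hm (mem_Ici.2 (le_max_right _ _)) (mem_Ici.2 (le_max_right _ _))
    (max_le_max_right 0 hab), fun s => ?_, fun t ht => ?_⟩
  · have := hm self_mem_Ici (mem_Ici.2 (le_max_right s 0)) (le_max_right s 0)
    rwa [h0] at this
  · rw [h t ht]
    refine intervalIntegral.integral_congr fun s hs => ?_
    rw [uIcc_of_le ht] at hs
    simp [hs.1]

theorem IsYoungFunction.continuousOn {Φ : ℝ → ℝ} (h : IsYoungFunction Φ) :
    ContinuousOn Φ (Ici 0) := by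
  obtain ⟨φ, hm, -, h⟩ := h.exists_monotone
  exact (intervalIntegral.continuous_primitive
    (fun a b => hm.intervalIntegrable) 0).continuousOn.congr fun t ht => h t ht

theorem IsYoungFunction.monotoneOn {Φ : ℝ → ℝ} (h : IsYoungFunction Φ) :
    MonotoneOn Φ (Ici 0) := by
  obtain ⟨φ, hm, hnn, h⟩ := h.exists_monotone
  intro a ha b hb hab
  rw [h a ha, h b hb]
  exact intervalIntegral.integral_mono_interval le_rfl ha hab
    (ae_of_all _ hnn) hm.intervalIntegrable

/-! ### Removing the weight `f` and the scaling `k` -/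

section Domination

variable {α : Type*} [MeasurableSpace α] {ν : Measure α} {f : α → ℝ}

theorem exists_setIntegral_lt_superlevel (hf : Integrable f ν) (hf0 : ∀ s, 0 ≤ f s)
    {ε : ℝ} (hε : 0 < ε) :
    ∃ A : ℝ, 0 ≤ A ∧ ∫ s, {s | A < f s}.indicator f s ∂ν ≤ ε := by
  have h : Tendsto (fun n : ℕ => ∫ s, {s | (n : ℝ) < f s}.indicator f s ∂ν) atTop
      (𝓝 (∫ _, (0 : ℝ) ∂ν)) := by
    refine tendsto_integral_of_dominated_convergence f (fun n => ?_) hf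
      (fun n => ae_of_all _ fun s => ?_) (ae_of_all _ fun s => ?_)
    · exact hf.1.indicator₀ (nullMeasurableSet_lt aemeasurable_const hf.1.aemeasurable)
    · rw [Real.norm_of_nonneg (indicator_nonneg (fun s _ => hf0 s) s)]
      exact indicator_le_self' (fun s _ => hf0 s) s
    · refine tendsto_const_nhds.congr' ?_
      filter_upwards [eventually_ge_atTop ⌈f s⌉₊] with n hn
      rw [indicator_of_notMem]
      simpa using (Nat.le_ceil _).trans (Nat.cast_le.2 hn)
  rw [integral_zero] at h
  obtain ⟨n, hn⟩ := (h.eventually (ge_mem_nhds hε)).exists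
  exact ⟨n, n.cast_nonneg, hn⟩

theorem exists_integrable_ge_of_summable {g : ℕ → α → ℝ} (hg : ∀ n, Integrable (g n) ν)
    (hg0 : ∀ n s, 0 ≤ g n s) {b : ℕ → ℝ} (hb : Summable b) (hgb : ∀ n, ∫ s, g n s ∂ν ≤ b n) :
    ∃ F : α → ℝ, Integrable F ν ∧ (∀ s, 0 ≤ F s) ∧ ∀ᵐ s ∂ν, ∀ n, g n s ≤ F s := by
  have hm : ∀ n, AEMeasurable (fun s => ENNReal.ofReal (g n s)) ν := fun n =>
    (hg n).1.aemeasurable.ennreal_ofReal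
  have hfin : ∫⁻ s, ∑' n, ENNReal.ofReal (g n s) ∂ν ≠ ∞ := by
    rw [lintegral_tsum hm]
    refine ne_top_of_le_ne_top hb.tsum_ofReal_ne_top (ENNReal.tsum_le_tsum fun n => ?_)
    rw [← ofReal_integral_eq_lintegral_ofReal (hg n) (ae_of_all _ (hg0 n))]
    exact ENNReal.ofReal_le_ofReal (hgb n)
  refine ⟨fun s => (∑' n, ENNReal.ofReal (g n s)).toReal,
    integrable_toReal_of_lintegral_ne_top (AEMeasurable.tsum hm) hfin,
    fun s => ENNReal.toReal_nonneg, ?_⟩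
  filter_upwards [ae_lt_top' (AEMeasurable.tsum hm) hfin] with s hs n
  exact (ENNReal.ofReal_le_iff_le_toReal hs.ne).1 (ENNReal.le_tsum n)

/-- The point is that `C` does not depend on `k`. If `r ≥ max k 1` and `n = ⌊r⌋`, then `k r ≤ (n +
1)²`, so `w (k r) ≤ W n` without reference to `k`. Cut `f` at a level `A n`: the bounded part goes
into `C`, and the excesses, weighted by `W n`, have summable integrals and go into `F`. Smaller `r`
cost at most `f s * w ((max k 1)²)`, also put into `F`. -/
theorem exists_isClassKInfty_mul_le_add (hf : Integrable f ν) (hf0 : ∀ s, 0 ≤ f s)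
    {w : ℝ → ℝ} (hw : MonotoneOn w (Ici 0)) (hw0 : w 0 = 0) :
    ∃ C : ℝ → ℝ, IsClassKInfty C ∧ ∀ k : ℝ, 0 < k → ∃ F : α → ℝ, Integrable F ν ∧
      (∀ s, 0 ≤ F s) ∧ ∀ᵐ s ∂ν, ∀ r, 0 ≤ r → f s * w (k * r) ≤ F s + C r := by
  have hwnn : ∀ r, 0 ≤ r → 0 ≤ w r := fun r hr => hw0 ▸ hw self_mem_Ici hr hr
  set W : ℕ → ℝ := fun n => w ((n + 1 : ℝ) ^ 2) with hW
  have hWnn : ∀ n, 0 ≤ W n := fun n => hwnn _ (by positivity)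
  have hWm : Monotone W := fun m n hmn => hw (by simp; positivity) (by simp; positivity) (by gcongr)
  -- The `+ 1` guards against `W n = 0`.
  have hex : ∀ n : ℕ, ∃ A : ℝ, 0 ≤ A ∧
      ∫ s, {s | A < f s}.indicator f s ∂ν ≤ (1 / 2) ^ n / (W n + 1) := fun n =>
    exists_setIntegral_lt_superlevel hf hf0 (by have := hWnn n; positivity)
  choose A hA0 hA using hex
  have hms : ∀ n, NullMeasurableSet {s | A n < f s} ν := fun n =>
    nullMeasurableSet_lt aemeasurable_const hf.1.aemeasurable
  obtain ⟨F, hF, hFnn, hFle⟩ := exists_integrable_ge_of_summable (ν := ν)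
    (g := fun n s => {s | A n < f s}.indicator f s * W n)
    (fun n => (hf.indicator₀ (hms n)).mul_const _)
    (fun n s => mul_nonneg (indicator_nonneg (fun s _ => hf0 s) s) (hWnn n))
    (summable_geometric_of_lt_one (r := (1 / 2 : ℝ)) (by norm_num) (by norm_num)) (fun n => by
      rw [integral_mul_const]
      calc _ ≤ (1 / 2) ^ n / (W n + 1) * W n := mul_le_mul_of_nonneg_right (hA n) (hWnn n)
        _ ≤ (1 / 2) ^ n / (W n + 1) * (W n + 1) := by
          have := hWnn n
          gcongr
          linarith
        _ = _ := div_mul_cancel₀ _ (by have := hWnn n; positivity))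
  -- Partial sums replace the levels `A n` by monotone ones, as a monotone majorant is needed for
  -- `C`.
  set D : ℕ → ℝ := fun n => ∑ i ∈ Finset.range (n + 1), A i with hD
  have hDnn : ∀ n, 0 ≤ D n := fun n => Finset.sum_nonneg fun i _ => hA0 i
  have hDm : Monotone D := fun m n hmn => Finset.sum_le_sum_of_subset_of_nonneg
    (Finset.range_mono (by omega)) fun i _ _ => hA0 i
  have hAD : ∀ n, A n ≤ D n := fun n =>
    Finset.single_le_sum (fun i _ => hA0 i) (Finset.self_mem_range_succ n)
  obtain ⟨C, hC, hCle⟩ := exists_isClassKInfty_ge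
    (h := fun r => if r < 1 then 0 else D ⌊r⌋₊ * W ⌊r⌋₊) (by
      intro a ha b hb hab
      dsimp only
      split_ifs with h1 h2 h2
      · exact le_rfl
      · exact mul_nonneg (hDnn _) (hWnn _)
      · linarith
      · have := Nat.floor_mono hab
        exact mul_le_mul (hDm this) (hWm this) (hWnn _) (hDnn _)) (by
      intro a ha
      split_ifs
      · exact le_rfl
      · exact mul_nonneg (hDnn _) (hWnn _)) (by
      intro ε hε
      refine ⟨1 / 2, by norm_num, fun a ha ha' => ?_⟩
      rw [if_pos (by linarith)]
      exact hε.le)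
  have hCnn : ∀ r, 0 ≤ r → 0 ≤ C r := fun r hr => hC.1.nonneg hr
  refine ⟨C, hC, fun k hk => ⟨fun s => F s + f s * w (max k 1 * max k 1),
    hF.add (hf.mul_const _), fun s => add_nonneg (hFnn s) (mul_nonneg (hf0 s)
      (hwnn _ (by positivity))), ?_⟩⟩
  filter_upwards [hFle] with s hs r hr
  have hw1 := hwnn (max k 1 * max k 1) (by positivity)
  rcases lt_or_ge r (max k 1) with hlt | hge
  · have : w (k * r) ≤ w (max k 1 * max k 1) := hw (mem_Ici.2 (by positivity))
      (mem_Ici.2 (by positivity)) (mul_le_mul (le_max_left _ _) hlt.le hr (by positivity))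
    have := mul_le_mul_of_nonneg_left this (hf0 s)
    linarith [hFnn s, hCnn r hr]
  · have hk' := (le_max_left k 1).trans hge
    have h1 := (le_max_right k 1).trans hge
    have h2 := hCle r hr
    rw [if_neg (not_lt.2 h1)] at h2
    set n := ⌊r⌋₊
    have h3 : w (k * r) ≤ W n := hw (mem_Ici.2 (by positivity)) (mem_Ici.2 (by positivity)) (by
      have := (Nat.lt_floor_add_one r).le
      rw [pow_two]
      exact mul_le_mul (hk'.trans this) this hr (by positivity))
    have h4 : f s * W n ≤ D n * W n + {s | A n < f s}.indicator f s * W n := by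
      rw [← add_mul]
      refine mul_le_mul_of_nonneg_right ?_ (hWnn n)
      by_cases h : A n < f s
      · rw [indicator_of_mem (by exact h)]
        linarith [hDnn n]
      · rw [indicator_of_notMem (by exact h)]
        linarith [hAD n]
    have h5 := hs n
    have h6 := mul_le_mul_of_nonneg_left h3 (hf0 s)
    have h7 := mul_nonneg (hf0 s) hw1
    linarith

/-- The bound by `M` is the integrated domination. For small `∫ C(φ)`, three thirds add up to `1`:
where `φ ≤ ε`, use `w (k φ) ≤ w (k ε)`; elsewhere, on a set of small measure by Markov's inequality,
the integral of `F` is small; the last third is `∫ C(φ)`. -/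
theorem exists_isClassKInfty_integral_bounds [IsFiniteMeasure ν] (hf : Integrable f ν)
    (hf0 : ∀ s, 0 ≤ f s) {w : ℝ → ℝ} (hw : MonotoneOn w (Ici 0)) (hw0 : w 0 = 0)
    (hwc : ContinuousOn w (Ici 0)) :
    ∃ C : ℝ → ℝ, IsClassKInfty C ∧ ∀ k : ℝ, 0 < k →
      (∃ M : ℝ, 0 ≤ M ∧ ∀ φ : α → ℝ, (∀ s, 0 ≤ φ s) → Integrable (fun s => C (φ s)) ν →
        Integrable (fun s => f s * w (k * φ s)) ν →
        ∫ s, f s * w (k * φ s) ∂ν ≤ M + ∫ s, C (φ s) ∂ν) ∧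
      ∃ δ : ℝ, 0 < δ ∧ ∀ φ : α → ℝ, (∀ s, 0 ≤ φ s) → Integrable (fun s => C (φ s)) ν →
        Integrable (fun s => f s * w (k * φ s)) ν →
        ∫ s, C (φ s) ∂ν ≤ δ → ∫ s, f s * w (k * φ s) ∂ν ≤ 1 := by
  obtain ⟨C, hC, h⟩ := exists_isClassKInfty_mul_le_add hf hf0 hw hw0
  have hCnn : ∀ r, 0 ≤ r → 0 ≤ C r := fun r hr => hC.1.nonneg hr
  refine ⟨C, hC, fun k hk => ?_⟩
  obtain ⟨F, hF, hFnn, hle⟩ := h k hk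
  refine ⟨⟨∫ s, F s ∂ν, integral_nonneg hFnn, fun φ hφ hi1 hi2 => ?_⟩, ?_⟩
  · rw [← integral_add hF hi1]
    refine integral_mono_ae hi2 (hF.add hi1) ?_
    filter_upwards [hle] with s hs using hs _ (hφ s)
  have hIf : 0 ≤ ∫ s, f s ∂ν := integral_nonneg hf0
  obtain ⟨ε, hε, hεw⟩ : ∃ ε > 0, w (k * ε) ≤ 1 / (3 * ((∫ s, f s ∂ν) + 1)) := by
    have h1 : Tendsto (fun e => w (k * e)) (𝓝[>] 0) (𝓝 (w 0)) := by
      refine (hwc 0 self_mem_Ici).tendsto.comp (tendsto_nhdsWithin_iff.2 ⟨?_, ?_⟩)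
      · have : Tendsto (fun e : ℝ => k * e) (𝓝 0) (𝓝 (k * 0)) :=
          (continuous_const.mul continuous_id).tendsto 0
        rw [mul_zero] at this
        exact this.mono_left nhdsWithin_le_nhds
      · filter_upwards [self_mem_nhdsWithin] with e he
        exact mul_nonneg hk.le (le_of_lt he)
    rw [hw0] at h1
    obtain ⟨e, he1, he2⟩ := ((h1.eventually (ge_mem_nhds (show (0 : ℝ) <
      1 / (3 * ((∫ s, f s ∂ν) + 1)) by positivity))).and self_mem_nhdsWithin).exists
    exact ⟨e, he2, he1⟩
  have hCε : 0 < C ε := hC.1.1 ▸ hC.1.2.2 self_mem_Ici hε.le hε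
  obtain ⟨η, hη, hηF⟩ : ∃ η : ℝ, 0 < η ∧ ∀ S : Set α, ν.real S ≤ η →
      ∫ s in S, F s ∂ν ≤ 1 / 3 := by
    obtain ⟨η, hη, H⟩ := exists_pos_setLIntegral_lt_of_measure_lt (μ := ν)
      (f := fun s => ENNReal.ofReal (F s)) (by
        rw [← ofReal_integral_eq_lintegral_ofReal hF (ae_of_all _ hFnn)]
        exact ENNReal.ofReal_ne_top) (ε := ENNReal.ofReal (1 / 3)) (by simp)
    obtain ⟨q, hq0, hq⟩ := ENNReal.lt_iff_exists_nnreal_btwn.1 hη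
    refine ⟨q, by exact_mod_cast hq0, fun S hS => ?_⟩
    have := H S (lt_of_le_of_lt ?_ hq)
    · rw [← ofReal_integral_eq_lintegral_ofReal hF.integrableOn (ae_of_all _ hFnn)] at this
      exact ((ENNReal.ofReal_lt_ofReal_iff (by norm_num)).1 this).le
    · rw [← ENNReal.ofReal_toReal (measure_ne_top ν S), ← ENNReal.ofReal_coe_nnreal]
      exact ENNReal.ofReal_le_ofReal hS
  refine ⟨min (1 / 3) (C ε * η), by positivity, fun φ hφ hi1 hi2 hδ => ?_⟩
  -- The set is described through `C ∘ φ`, which is measurable, since `φ` itself is not assumed to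
  -- be.
  have hmS : NullMeasurableSet {s | C ε ≤ C (φ s)} ν :=
    nullMeasurableSet_le aemeasurable_const hi1.1.aemeasurable
  set S := {s | C ε ≤ C (φ s)}
  have hνS : ν.real S ≤ η := by
    have := mul_meas_ge_le_integral_of_nonneg (ae_of_all ν fun s => hCnn _ (hφ s)) hi1 (C ε)
    exact le_of_mul_le_mul_left (this.trans (hδ.trans (min_le_right _ _))) hCε
  have hpt : ∀ᵐ s ∂ν, f s * w (k * φ s) ≤
      (S.indicator F s + C (φ s)) + f s * w (k * ε) := by
    filter_upwards [hle] with s hs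
    have hwε : 0 ≤ w (k * ε) := hw0 ▸ hw self_mem_Ici (mem_Ici.2 (by positivity)) (by positivity)
    by_cases hsS : s ∈ S
    · rw [indicator_of_mem hsS]
      linarith [hs _ (hφ s), mul_nonneg (hf0 s) hwε]
    · rw [indicator_of_notMem hsS]
      have : φ s ≤ ε := by
        by_contra! hlt
        exact hsS (hC.1.2.2.monotoneOn hε.le (hφ s) hlt.le)
      have := hw (mem_Ici.2 (mul_nonneg hk.le (hφ s))) (mem_Ici.2 (by positivity))
        (mul_le_mul_of_nonneg_left this hk.le)
      linarith [mul_le_mul_of_nonneg_left this (hf0 s), hCnn _ (hφ s)]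
  have hint := integral_mono_ae hi2
    (((hF.indicator₀ hmS).add hi1).add (hf.mul_const (w (k * ε)))) hpt
  have e1 : ∫ s, (S.indicator F s + C (φ s)) + f s * w (k * ε) ∂ν =
      (∫ s in S, F s ∂ν) + (∫ s, C (φ s) ∂ν) + (∫ s, f s ∂ν) * w (k * ε) := by
    have h1 : Integrable (fun s => S.indicator F s + C (φ s)) ν := (hF.indicator₀ hmS).add hi1
    rw [integral_add h1 (hf.mul_const _), integral_add (hF.indicator₀ hmS) hi1,
      integral_indicator₀ hmS, integral_mul_const]
  have e2 : (∫ s, f s ∂ν) * w (k * ε) ≤ 1 / 3 := by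
    calc _ ≤ (∫ s, f s ∂ν) * (1 / (3 * ((∫ s, f s ∂ν) + 1))) :=
          mul_le_mul_of_nonneg_left hεw hIf
      _ ≤ 1 / 3 := by
        rw [mul_one_div, div_le_div_iff₀ (by positivity) (by norm_num)]
        linarith
  have e3 := hδ.trans (min_le_left _ _)
  have e4 := hηF S hνS
  calc _ ≤ _ := hint
    _ = _ := e1
    _ ≤ 1 := by linarith

end Domination

/-! ### Essentially bounded inputs -/

section BoundedComposition

variable {α E : Type*} [MeasurableSpace α] {ν : Measure α} [NormedAddCommGroup E]

theorem MeasureTheory.MemLp.comp_norm_of_continuousOn {q : ℝ → ℝ}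
    (hq : ContinuousOn q (Ici 0)) {v : α → E} (hv : MemLp v ∞ ν) :
    MemLp (fun s => q ‖v s‖) ∞ ν := by
  obtain ⟨K, hK⟩ := (isCompact_Icc (a := (0 : ℝ)) (b :=
    (eLpNormEssSup v ν).toReal)).exists_bound_of_continuousOn (hq.mono Icc_subset_Ici_self)
  have hm : Continuous fun r : ℝ => q (max r 0) :=
    hq.comp_continuous (continuous_id.max continuous_const) fun r => mem_Ici.2 (le_max_right _ _)
  refine memLp_top_of_bound ?_ K ?_
  · refine (hm.comp_aestronglyMeasurable hv.1.norm).congr (ae_of_all _ fun s => ?_)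
    simp
  · have hfin : eLpNormEssSup v ν ≠ ∞ := by
      have := hv.2.ne
      rwa [eLpNorm_exponent_top] at this
    filter_upwards [enorm_ae_le_eLpNormEssSup v ν] with s hs
    refine hK _ ⟨norm_nonneg _, ?_⟩
    rw [← toReal_enorm]
    exact ENNReal.toReal_mono hfin hs

theorem MeasureTheory.MemLp.intervalIntegrable_of_top {g : ℝ → E}
    (hg : MemLp g ∞ volume) (a b : ℝ) : IntervalIntegrable g volume a b :=
  ⟨(hg.restrict _).integrable le_top, (hg.restrict _).integrable le_top⟩

end BoundedComposition

/-! ### The gain on the unit interval -/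

section UnitTime

variable {𝕜 X U : Type*} [RCLike 𝕜] [NormedAddCommGroup X] [NormedSpace 𝕜 X]
  [NormedAddCommGroup U] [NormedSpace 𝕜 U]

theorem exists_unit_time_gain (T : C0Semigroup 𝕜 X) (lam : T.resolventSet)
    (B : U →L[𝕜] T.Extrap lam)
    (f : ℝ → ℝ) (hf : IntegrableOn f (Ioo 0 1)) (hf0 : ∀ᵐ s ∂volume.restrict (Ioo 0 1), 0 ≤ f s)
    (θ : ℝ → ℝ) (hθ : IsClassK θ) (c : ℝ) (hc : 0 < c)
    (μ : ℝ → ℝ) (hμ : IsYoungFunction μ)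
    (hbound : ∀ u : ℝ → U, IsLpInput 1 1 u →
      IntegrableOn (fun s => f s * μ ‖u s‖) (Ioo 0 1) →
      ∃ x : X, T.toExtrap lam x =
          ∫ s in (0 : ℝ)..1, T.extrapOp lam s.toNNReal (B (u s)) ∧
        ‖x‖ ≤ c + θ (∫ s in (0 : ℝ)..1, f s * μ ‖u s‖)) :
    ∃ C η : ℝ → ℝ, IsClassKInfty C ∧ IsClassKInfty η ∧ ∀ u : ℝ → U, IsLpInput ∞ 1 u →
      ∃ x : X, T.toExtrap lam x = ∫ s in (0 : ℝ)..1, T.extrapOp lam s.toNNReal (B (u s)) ∧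
        ‖x‖ ≤ η (∫ s in (0 : ℝ)..1, C ‖u s‖) := by
  set ν : Measure ℝ := volume.restrict (Ioo 0 1) with hν
  have hint : ∀ g : ℝ → ℝ, ∫ s in (0 : ℝ)..1, g s = ∫ s, g s ∂ν := fun g => by
    rw [intervalIntegral.integral_of_le zero_le_one, integral_Ioc_eq_integral_Ioo]
  -- The positive part is used because `f` is nonnegative only almost everywhere.
  obtain ⟨C, hC, hCk⟩ := exists_isClassKInfty_integral_bounds (ν := ν)
    (f := fun s => max (f s) 0) hf.pos_part (fun s => le_max_right _ _) hμ.monotoneOn hμ.zero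
    hμ.continuousOn
  have hfpos : ∀ᵐ s ∂ν, max (f s) 0 = f s := hf0.mono fun s hs => max_eq_left hs
  have hCint : ∀ u : ℝ → U, IsLpInput ∞ 1 u → Integrable (fun s => C ‖u s‖) ν := fun u hu =>
    (MemLp.comp_norm_of_continuousOn hC.1.2.1 hu).integrable le_top
  have hμint : ∀ u : ℝ → U, IsLpInput ∞ 1 u → ∀ k : ℝ, 0 < k →
      Integrable (fun s => max (f s) 0 * μ (k * ‖u s‖)) ν := fun u hu k hk => by
    have hq : ContinuousOn (fun r => μ (k * r)) (Ici 0) :=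
      hμ.continuousOn.comp (continuous_const.mul continuous_id).continuousOn
        fun r hr => mul_nonneg hk.le hr
    have := (MemLp.comp_norm_of_continuousOn hq hu).mul (p := 1) (r := 1)
      (memLp_one_iff_integrable.2 hf.pos_part)
    exact memLp_one_iff_integrable.1 this
  have key : ∀ u : ℝ → U, IsLpInput ∞ 1 u → ∀ k : ℝ, 0 < k →
      ∃ x : X, T.toExtrap lam x = ∫ s in (0 : ℝ)..1, T.extrapOp lam s.toNNReal (B (u s)) ∧
        ‖x‖ ≤ (c + θ (∫ s, max (f s) 0 * μ (k * ‖u s‖) ∂ν)) / k := by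
    intro u hu k hk
    have hnorm : ∀ s, ‖((k : ℝ) : 𝕜) • u s‖ = k * ‖u s‖ := fun s => by
      rw [norm_smul, RCLike.norm_ofReal, abs_of_pos hk]
    have hae : (fun s => max (f s) 0 * μ (k * ‖u s‖)) =ᵐ[ν]
        fun s => f s * μ ‖((k : ℝ) : 𝕜) • u s‖ := by
      filter_upwards [hfpos] with s hs
      rw [hs, hnorm]
    obtain ⟨x, hx, hxn⟩ := hbound (fun s => ((k : ℝ) : 𝕜) • u s)
      ((hu.mono_exponent le_top).const_smul _) ((hμint u hu k hk).congr hae)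
    have hk0 : ((k : ℝ) : 𝕜) ≠ 0 := RCLike.ofReal_ne_zero.2 hk.ne'
    refine ⟨((k : ℝ) : 𝕜)⁻¹ • x, ?_, ?_⟩
    · rw [map_smul, hx]
      simp only [map_smul]
      rw [intervalIntegral.integral_smul, inv_smul_smul₀ hk0]
    · rw [norm_smul, norm_inv, RCLike.norm_ofReal, abs_of_pos hk, div_eq_inv_mul]
      refine mul_le_mul_of_nonneg_left ?_ (inv_nonneg.2 hk.le)
      rwa [hint, ← integral_congr_ae hae] at hxn
  -- The embedding into `X₋₁` is injective, so the bounds for all `k` concern the same `x`.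
  have key' : ∀ u : ℝ → U, IsLpInput ∞ 1 u → ∀ x : X, T.toExtrap lam x =
      ∫ s in (0 : ℝ)..1, T.extrapOp lam s.toNNReal (B (u s)) → ∀ k : ℝ, 0 < k →
        ‖x‖ ≤ (c + θ (∫ s, max (f s) 0 * μ (k * ‖u s‖) ∂ν)) / k := by
    intro u hu x hx k hk
    obtain ⟨y, hy, hyn⟩ := key u hu k hk
    rwa [T.toExtrap_injective lam (hx.trans hy.symm)]
  have hμnn : ∀ u : ℝ → U, ∀ k : ℝ, 0 < k →
      0 ≤ ∫ s, max (f s) 0 * μ (k * ‖u s‖) ∂ν := fun u k hk =>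
    integral_nonneg fun s => mul_nonneg (le_max_right _ _)
      (hμ.zero ▸ hμ.monotoneOn self_mem_Ici (mem_Ici.2 (by positivity)) (by positivity))
  -- The norms reachable with budget `a`; their supremum is the optimal gain, finite by the case `k
  -- = 1`.
  set N : ℝ → Set ℝ := fun a => {r | ∃ (u : ℝ → U) (x : X), IsLpInput ∞ 1 u ∧
    T.toExtrap lam x = ∫ s in (0 : ℝ)..1, T.extrapOp lam s.toNNReal (B (u s)) ∧
    ∫ s, C ‖u s‖ ∂ν ≤ a ∧ ‖x‖ = r} with hN
  have hmem0 : ∀ a, 0 ≤ a → (0 : ℝ) ∈ N a := fun a ha =>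
    ⟨0, 0, MemLp.zero, by simp, by simpa [hC.1.1] using ha, norm_zero⟩
  have hbdd : ∀ a, 0 ≤ a → BddAbove (N a) := by
    intro a ha
    obtain ⟨⟨M, hM0, hM⟩, -⟩ := hCk 1 one_pos
    refine ⟨(c + θ (M + a)) / 1, ?_⟩
    rintro _ ⟨u, x, hu, hx, hua, rfl⟩
    refine (key' u hu x hx 1 one_pos).trans ?_
    gcongr
    exact hθ.2.2.monotoneOn (hμnn u 1 one_pos) (mem_Ici.2 (by positivity))
      ((hM _ (fun s => norm_nonneg _) (hCint u hu) (hμint u hu 1 one_pos)).trans (by gcongr))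
  obtain ⟨η, hη, hle⟩ := exists_isClassKInfty_ge (h := fun a => sSup (N a))
    (fun a ha b hb hab => csSup_le_csSup (hbdd b hb) ⟨0, hmem0 a ha⟩
      fun r ⟨u, x, hu, hx, hua, hr⟩ => ⟨u, x, hu, hx, hua.trans hab, hr⟩)
    (fun a ha => le_csSup (hbdd a ha) (hmem0 a ha)) (by
      intro ε hε
      have hθ1 := hθ.nonneg zero_le_one
      -- This `k` solves `(c + θ 1) / k = ε`.
      have hk : 0 < (c + θ 1) / ε := by positivity
      obtain ⟨-, δ, hδ, hk1⟩ := hCk ((c + θ 1) / ε) hk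
      refine ⟨δ, hδ, fun a ha haδ => csSup_le ⟨0, hmem0 a ha⟩ ?_⟩
      rintro _ ⟨u, x, hu, hx, hua, rfl⟩
      have h1 := hk1 _ (fun s => norm_nonneg _) (hCint u hu) (hμint u hu _ hk) (hua.trans haδ)
      refine (key' u hu x hx _ hk).trans ?_
      rw [div_le_iff₀ hk, mul_div_cancel₀ _ hε.ne']
      gcongr
      exact hθ.2.2.monotoneOn (hμnn u _ hk) (mem_Ici.2 zero_le_one) h1)
  refine ⟨C, η, hC, hη, fun u hu => ?_⟩
  obtain ⟨x, hx, -⟩ := key u hu 1 one_pos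
  have hnn : 0 ≤ ∫ s, C ‖u s‖ ∂ν := integral_nonneg fun s => hC.1.nonneg (norm_nonneg _)
  refine ⟨x, hx, ?_⟩
  rw [hint]
  exact (le_csSup (hbdd _ hnn) ⟨u, x, hu, hx, le_rfl, rfl⟩).trans (hle _ hnn)

end UnitTime

/-! ### The extrapolated semigroup and summation over unit intervals -/

namespace C0Semigroup

variable {𝕜 X U : Type*} [RCLike 𝕜] [NormedAddCommGroup X] [NormedSpace 𝕜 X]
  [NormedAddCommGroup U] [NormedSpace 𝕜 U]

theorem denseRange_toExtrap (T : C0Semigroup 𝕜 X) (lam : T.resolventSet) :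
    DenseRange (T.toExtrap lam) :=
  UniformSpace.Completion.denseRange_coe (α := T.PreExtrap lam)

theorem extrapOp_add (T : C0Semigroup 𝕜 X) (lam : T.resolventSet) (s t : ℝ≥0)
    (y : T.Extrap lam) :
    T.extrapOp lam (s + t) y = T.extrapOp lam s (T.extrapOp lam t y) := by
  refine (T.denseRange_toExtrap lam).induction_on y
    (isClosed_eq (T.extrapOp lam (s + t)).continuous
      ((T.extrapOp lam s).continuous.comp (T.extrapOp lam t).continuous)) fun x => ?_
  rw [extrapOp_toExtrap, extrapOp_toExtrap, extrapOp_toExtrap, T.op_add]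
  rfl

theorem norm_extrapOp_le (T : C0Semigroup 𝕜 X) (lam : T.resolventSet) (t : ℝ≥0)
    (y : T.Extrap lam) : ‖T.extrapOp lam t y‖ ≤ ‖T.op t‖ * ‖y‖ := by
  refine (T.denseRange_toExtrap lam).induction_on y
    (isClosed_le (T.extrapOp lam t).continuous.norm
      (continuous_const.mul continuous_norm)) fun x => ?_
  rw [extrapOp_toExtrap, norm_toExtrap, norm_toExtrap, resolvent_op]
  exact (T.op t).le_opNorm _

theorem continuous_toExtrap (T : C0Semigroup 𝕜 X) (lam : T.resolventSet) :
    Continuous (T.toExtrap lam) :=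
  AddMonoidHomClass.continuous_of_bound (T.toExtrap lam) ‖T.resolvent lam‖ fun x => by
    rw [norm_toExtrap]
    exact (T.resolvent lam).le_opNorm x

/-- Orbits are continuous on the dense image of `X`, and the uniform bound `M` extends this jointly
to `X₋₁`. It supplies the measurability of `s ↦ T₋₁(s) B v(s)`. -/
theorem continuous_extrapOp_uncurry (T : C0Semigroup 𝕜 X) (lam : T.resolventSet) {M : ℝ≥0}
    (hM : ∀ t, ‖T.op t‖ ≤ M) :
    Continuous fun p : ℝ × T.Extrap lam => T.extrapOp lam p.1.toNNReal p.2 := by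
  refine continuous_prod_of_dense_continuous_lipschitzWith' _ M (T.denseRange_toExtrap lam)
    (fun s => LipschitzWith.of_dist_le_mul fun y z => ?_) ?_
  · rw [dist_eq_norm, dist_eq_norm, ← map_sub]
    refine (T.norm_extrapOp_le lam _ _).trans ?_
    gcongr
    exact hM _
  · rintro _ ⟨x, rfl⟩
    simp only [extrapOp_toExtrap]
    exact (T.continuous_toExtrap lam).comp
      ((T.continuous_orbit x).comp continuous_real_toNNReal)

theorem memLp_top_extrapOp_comp (T : C0Semigroup 𝕜 X) (lam : T.resolventSet) {M : ℝ≥0}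
    (hM : ∀ t, ‖T.op t‖ ≤ M) (B : U →L[𝕜] T.Extrap lam) {v : ℝ → U} (hv : MemLp v ∞ volume) :
    MemLp (fun s : ℝ => T.extrapOp lam s.toNNReal (B (v s))) ∞ volume := by
  have h1 : AEStronglyMeasurable (fun s => B (v s)) volume :=
    B.continuous.comp_aestronglyMeasurable hv.1
  have h2 : AEStronglyMeasurable (fun s : ℝ => T.extrapOp lam s.toNNReal (B (v s))) volume :=
    (T.continuous_extrapOp_uncurry lam hM).comp_aestronglyMeasurable
      (f := fun s : ℝ => (s, B (v s))) (aestronglyMeasurable_id.prodMk h1)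
  refine MemLp.of_le_mul (c := M * ‖B‖) hv h2 (ae_of_all _ fun s => ?_)
  calc ‖T.extrapOp lam s.toNNReal (B (v s))‖ ≤ ‖T.op s.toNNReal‖ * ‖B (v s)‖ :=
        T.norm_extrapOp_le lam _ _
    _ ≤ M * (‖B‖ * ‖v s‖) := by
        gcongr
        · exact hM _
        · exact B.le_opNorm _
    _ = M * ‖B‖ * ‖v s‖ := by ring

/-- The value of the input map at time `m` decomposes into contributions of unit intervals. -/
theorem integral_extrapOp_eq_sum (T : C0Semigroup 𝕜 X) (lam : T.resolventSet) {M : ℝ≥0}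
    (hM : ∀ t, ‖T.op t‖ ≤ M) (B : U →L[𝕜] T.Extrap lam) {v : ℝ → U} (hv : MemLp v ∞ volume)
    (m : ℕ) :
    ∫ s in (0 : ℝ)..m, T.extrapOp lam s.toNNReal (B (v s)) =
      ∑ n ∈ Finset.range m, T.extrapOp lam n
        (∫ s in (0 : ℝ)..1, T.extrapOp lam s.toNNReal (B (v (n + s)))) := by
  have hint := T.memLp_top_extrapOp_comp lam hM B hv
  have h := intervalIntegral.sum_integral_adjacent_intervals (a := fun n : ℕ => (n : ℝ)) (n := m)
    (μ := volume) (f := fun s : ℝ => T.extrapOp lam s.toNNReal (B (v s)))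
    fun k _ => MemLp.intervalIntegrable_of_top hint _ _
  simp only [Nat.cast_zero] at h
  rw [← h]
  refine Finset.sum_congr rfl fun n _ => ?_
  have hvn : MemLp (fun s => v (n + s)) ∞ volume :=
    hv.comp_measurePreserving (measurePreserving_add_left volume (n : ℝ))
  rw [← ContinuousLinearMap.intervalIntegral_comp_comm _
    (MemLp.intervalIntegrable_of_top (T.memLp_top_extrapOp_comp lam hM B hvn) _ _)]
  have h2 := intervalIntegral.integral_comp_add_left (a := 0) (b := 1)
    (fun s : ℝ => T.extrapOp lam s.toNNReal (B (v s))) (n : ℝ)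
  rw [add_zero] at h2
  push_cast
  rw [← h2]
  refine intervalIntegral.integral_congr fun s hs => ?_
  rw [uIcc_of_le zero_le_one] at hs
  rw [← extrapOp_add, Real.toNNReal_add n.cast_nonneg hs.1, Real.toNNReal_natCast]

/-- The terms from `N` on add up to at most half of the whole sum, so the sum is at most twice its
first `N` terms. -/
theorem exists_sum_norm_op_le (T : C0Semigroup 𝕜 X) {M : ℝ} (hM : ∀ t, ‖T.op t‖ ≤ M) {N : ℕ}
    (hN : ‖T.op N‖ ≤ 1 / 2) (m : ℕ) :
    ∑ n ∈ Finset.range m, ‖T.op n‖ ≤ 2 * (N * M) := by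
  have h1 : ∑ n ∈ Finset.range m, ‖T.op n‖ ≤ ∑ n ∈ Finset.range (N + m), ‖T.op n‖ :=
    Finset.sum_le_sum_of_subset_of_nonneg (Finset.range_mono (by omega))
      fun _ _ _ => norm_nonneg _
  rw [Finset.sum_range_add] at h1
  have h2 : ∑ n ∈ Finset.range N, ‖T.op n‖ ≤ N * M := by
    simpa using Finset.sum_le_card_nsmul (Finset.range N) (fun n : ℕ => ‖T.op n‖) M
      fun n _ => hM n
  have h3 : ∑ n ∈ Finset.range m, ‖T.op ((N + n : ℕ) : ℝ≥0)‖ ≤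
      1 / 2 * ∑ n ∈ Finset.range m, ‖T.op n‖ := by
    rw [Finset.mul_sum]
    refine Finset.sum_le_sum fun n _ => ?_
    rw [Nat.cast_add, T.op_add]
    exact (ContinuousLinearMap.opNorm_comp_le _ _).trans (by gcongr)
  linarith

end C0Semigroup

/-! ### From the unit-time gain to integral stability -/

section Stability

variable {𝕜 X U : Type*} [RCLike 𝕜] [NormedAddCommGroup X] [NormedSpace 𝕜 X]
  [NormedAddCommGroup U] [NormedSpace 𝕜 U]

theorem IsLinftyISS.exists_decay {T : C0Semigroup 𝕜 X} {lam : T.resolventSet}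
    {B : U →L[𝕜] T.Extrap lam} (h : IsLinftyISS T lam B) :
    ∃ β : ℝ → ℝ → ℝ, IsClassKL β ∧ ∀ (t : ℝ≥0) (x : X), ‖T.op t x‖ ≤ β ‖x‖ t := by
  obtain ⟨β, μ, hβ, hμ, h⟩ := h
  refine ⟨β, hβ, fun t x => ?_⟩
  obtain ⟨y, hy, hyn⟩ := h t x 0 MemLp.zero
  have hy' : y = T.op t x := T.toExtrap_injective lam (by simpa [mildSolution] using hy)
  have h0 : linftyNorm (t : ℝ) (0 : ℝ → U) = 0 := by simp [linftyNorm]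
  rwa [h0, hμ.1.1, add_zero, hy'] at hyn

theorem norm_op_le_of_decay {T : C0Semigroup 𝕜 X} {β : ℝ → ℝ → ℝ} (hβ : IsClassKL β)
    (h : ∀ (t : ℝ≥0) (x : X), ‖T.op t x‖ ≤ β ‖x‖ t) (t : ℝ≥0) : ‖T.op t‖ ≤ β 1 t :=
  ContinuousLinearMap.opNorm_le_of_unit_norm ((hβ.1 t t.2).nonneg zero_le_one)
    fun x hx => hx ▸ h t x

theorem IsClassKInfty.const_mul {g : ℝ → ℝ} (hg : IsClassKInfty g) {D : ℝ} (hD : 0 < D) :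
    IsClassKInfty fun r => D * g r :=
  ⟨⟨by simp [hg.1.1], continuousOn_const.mul hg.1.2.1,
    fun _ ha _ hb hab => mul_lt_mul_of_pos_left (hg.1.2.2 ha hb hab) hD⟩,
    hg.2.const_mul_atTop hD⟩

/-- Time reversal and extension by zero of an input on `(0, t)`. -/
noncomputable def reversedInput (t : ℝ≥0) (u : ℝ → U) (s : ℝ) : U :=
  (Ioo 0 (t : ℝ)).indicator u (t - s)

theorem memLp_reversedInput {t : ℝ≥0} {u : ℝ → U} (hu : IsLpInput ∞ t u) :
    MemLp (reversedInput t u) ∞ volume :=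
  ((memLp_indicator_iff_restrict measurableSet_Ioo).2 hu).comp_measurePreserving
    (Measure.measurePreserving_sub_left volume (t : ℝ))

/-- The reversed input vanishes beyond `t`, so rounding up to an integer time changes nothing. -/
theorem integral_mild_eq_integral_reversedInput (T : C0Semigroup 𝕜 X) (lam : T.resolventSet)
    {M : ℝ≥0} (hM : ∀ t, ‖T.op t‖ ≤ M) (B : U →L[𝕜] T.Extrap lam) {t : ℝ≥0} {u : ℝ → U}
    (hu : IsLpInput ∞ t u) :
    ∫ s in (0 : ℝ)..t, T.extrapOp lam ((t : ℝ) - s).toNNReal (B (u s)) =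
      ∫ s in (0 : ℝ)..⌈t⌉₊, T.extrapOp lam s.toNNReal (B (reversedInput t u s)) := by
  have hint := T.memLp_top_extrapOp_comp lam hM B (memLp_reversedInput hu)
  have htm : (t : ℝ) ≤ ⌈t⌉₊ := by exact_mod_cast Nat.le_ceil t
  have hzero : ∫ s in (t : ℝ)..⌈t⌉₊, T.extrapOp lam s.toNNReal (B (reversedInput t u s)) = 0 := by
    refine (intervalIntegral.integral_congr (g := fun _ => 0) fun s hs => ?_).trans (by simp)
    rw [uIcc_of_le htm] at hs
    have : reversedInput t u s = 0 :=
      indicator_of_notMem (fun h => by linarith [h.1, hs.1]) _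
    simp [this]
  rw [← intervalIntegral.integral_add_adjacent_intervals
    (MemLp.intervalIntegrable_of_top hint 0 t)
    (MemLp.intervalIntegrable_of_top hint t _), hzero, add_zero]
  have h := intervalIntegral.integral_comp_sub_left (a := 0) (b := t)
    (fun s : ℝ => T.extrapOp lam s.toNNReal (B (reversedInput t u s))) (t : ℝ)
  rw [sub_self, sub_zero] at h
  rw [← h, intervalIntegral.integral_of_le t.coe_nonneg,
    intervalIntegral.integral_of_le t.coe_nonneg,
    integral_Ioc_eq_integral_Ioo, integral_Ioc_eq_integral_Ioo]
  refine setIntegral_congr_fun measurableSet_Ioo fun s hs => ?_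
  simp only [reversedInput, sub_sub_cancel]
  rw [indicator_of_mem hs]

/-- Since `C 0 = 0`, the extension by zero adds nothing, and every unit window sees at most the full
integral, uniformly in `n`. -/
theorem integral_comp_norm_reversedInput_le {C : ℝ → ℝ} (hC : IsClassK C) {t : ℝ≥0} {u : ℝ → U}
    (hu : IsLpInput ∞ t u) (n : ℝ) :
    ∫ s in (0 : ℝ)..1, C ‖reversedInput t u (n + s)‖ ≤ ∫ s in (0 : ℝ)..t, C ‖u s‖ := by
  set g : ℝ → ℝ := (Ioo 0 (t : ℝ)).indicator fun s => C ‖u s‖ with hg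
  have hgi : Integrable g volume :=
    (integrable_indicator_iff measurableSet_Ioo).2
      ((MemLp.comp_norm_of_continuousOn hC.2.1 hu).integrable le_top)
  have hgnn : ∀ s, 0 ≤ g s := indicator_nonneg fun s _ => hC.nonneg (norm_nonneg _)
  have hrev : ∀ s, C ‖reversedInput t u (n + s)‖ = g (t - (n + s)) := fun s => by
    by_cases h : (t : ℝ) - (n + s) ∈ Ioo 0 (t : ℝ)
    · simp only [reversedInput, hg, indicator_of_mem h]
    · simp only [reversedInput, hg, indicator_of_notMem h, norm_zero, hC.1]
  simp only [hrev]
  rw [intervalIntegral.integral_of_le zero_le_one, intervalIntegral.integral_of_le t.coe_nonneg,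
    integral_Ioc_eq_integral_Ioo (f := fun s => C ‖u s‖), ← integral_indicator measurableSet_Ioo]
  calc _ ≤ ∫ s, g (t - (n + s)) :=
        setIntegral_le_integral ((hgi.comp_sub_left (t : ℝ)).comp_add_left n)
          (ae_of_all _ fun s => hgnn _)
    _ = ∫ s, g (t - s) := integral_add_left_eq_self (fun s => g (t - s)) n
    _ = ∫ s, g s := integral_sub_left_eq_self g volume (t : ℝ)

/-- A unit-time gain together with stability of the semigroup gives integral stability. -/
theorem isLinftyIISS_of_unit_time_gain {T : C0Semigroup 𝕜 X} {lam : T.resolventSet}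
    {B : U →L[𝕜] T.Extrap lam} {β : ℝ → ℝ → ℝ} (hβ : IsClassKL β)
    (hT : ∀ (t : ℝ≥0) (x : X), ‖T.op t x‖ ≤ β ‖x‖ t)
    {C η : ℝ → ℝ} (hC : IsClassKInfty C) (hη : IsClassKInfty η)
    (hgain : ∀ u : ℝ → U, IsLpInput ∞ 1 u →
      ∃ x : X, T.toExtrap lam x = ∫ s in (0 : ℝ)..1, T.extrapOp lam s.toNNReal (B (u s)) ∧
        ‖x‖ ≤ η (∫ s in (0 : ℝ)..1, C ‖u s‖)) :
    IsLinftyIISS T lam B := by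
  have hop := norm_op_le_of_decay hβ hT
  have hL := hβ.2 1 one_pos
  set M : ℝ≥0 := (β 1 0).toNNReal with hMdef
  have hM : ∀ t, ‖T.op t‖ ≤ M := fun t => (hop t).trans
    ((hL.2.1.antitoneOn self_mem_Ici t.2 t.2).trans (Real.le_coe_toNNReal _))
  obtain ⟨N, hN⟩ : ∃ N : ℕ, β 1 N ≤ 1 / 2 :=
    ((hL.2.2.comp tendsto_natCast_atTop_atTop).eventually
      (ge_mem_nhds (show (0 : ℝ) < 1 / 2 by norm_num))).exists
  have hsum := T.exists_sum_norm_op_le hM (N := N)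
    ((hop N).trans (by rwa [NNReal.coe_natCast]))
  -- The `+ 1` keeps the factor positive when `N * M = 0`, so that the product stays in `𝒦_∞`.
  refine ⟨β, fun r => (2 * (N * M) + 1) * η r, C, hβ, hη.const_mul (by positivity), hC.1,
    fun t x₀ u hu => ?_⟩
  have hv := memLp_reversedInput hu
  have hex : ∀ n : ℕ, ∃ x : X, T.toExtrap lam x = ∫ s in (0 : ℝ)..1,
      T.extrapOp lam s.toNNReal (B (reversedInput t u (n + s))) ∧
      ‖x‖ ≤ η (∫ s in (0 : ℝ)..t, C ‖u s‖) := fun n => by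
    obtain ⟨x, hx, hxn⟩ := hgain (fun s => reversedInput t u (n + s))
      ((hv.comp_measurePreserving (measurePreserving_add_left volume (n : ℝ))).restrict _)
    refine ⟨x, hx, hxn.trans (hη.1.2.2.monotoneOn ?_ ?_
      (integral_comp_norm_reversedInput_le hC.1 hu n))⟩
    · exact intervalIntegral.integral_nonneg zero_le_one fun s _ => hC.1.nonneg (norm_nonneg _)
    · exact intervalIntegral.integral_nonneg t.2 fun s _ => hC.1.nonneg (norm_nonneg _)
  choose x hx hxn using hex
  have hηnn : 0 ≤ η (∫ s in (0 : ℝ)..t, C ‖u s‖) := (norm_nonneg _).trans (hxn 0)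
  refine ⟨T.op t x₀ + ∑ n ∈ Finset.range ⌈t⌉₊, T.op n (x n), ?_, ?_⟩
  · rw [mildSolution, integral_mild_eq_integral_reversedInput T lam hM B hu,
      T.integral_extrapOp_eq_sum lam hM B hv, map_add, map_sum]
    congr 1
    exact Finset.sum_congr rfl fun n _ => by rw [← hx n, T.extrapOp_toExtrap]
  · refine (norm_add_le _ _).trans (add_le_add (hT t x₀) ?_)
    calc ‖∑ n ∈ Finset.range ⌈t⌉₊, T.op n (x n)‖
        ≤ ∑ n ∈ Finset.range ⌈t⌉₊, ‖T.op n‖ * η (∫ s in (0 : ℝ)..t, C ‖u s‖) :=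
          norm_sum_le_of_le _ fun n _ => ((T.op n).le_opNorm _).trans (by gcongr; exact hxn n)
      _ = (∑ n ∈ Finset.range ⌈t⌉₊, ‖T.op n‖) * η (∫ s in (0 : ℝ)..t, C ‖u s‖) := by
          rw [Finset.sum_mul]
      _ ≤ (2 * (N * M) + 1) * η (∫ s in (0 : ℝ)..t, C ‖u s‖) := by
          gcongr
          linarith [hsum ⌈t⌉₊]

end Stability

theorem mainTheorem5 {𝕜 X U : Type*} [RCLike 𝕜]
    [NormedAddCommGroup X] [NormedSpace 𝕜 X] [CompleteSpace X]
    [NormedAddCommGroup U] [NormedSpace 𝕜 U] [CompleteSpace U]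
    (T : C0Semigroup 𝕜 X) (lam : T.resolventSet) (B : U →L[𝕜] T.Extrap lam)
    (hISS : IsLinftyISS T lam B)
    (f : ℝ → ℝ) (hf : IntegrableOn f (Ioo 0 1)) (hf0 : ∀ᵐ s ∂volume.restrict (Ioo 0 1), 0 ≤ f s)
    (θ : ℝ → ℝ) (hθ : IsClassK θ) (c : ℝ) (hc : 0 < c)
    (μ : ℝ → ℝ) (hμ : IsYoungFunction μ)
    (hbound : ∀ u : ℝ → U, IsLpInput 1 1 u →
      IntegrableOn (fun s => f s * μ ‖u s‖) (Ioo 0 1) →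
      ∃ x : X, T.toExtrap lam x =
          ∫ s in (0 : ℝ)..1, T.extrapOp lam s.toNNReal (B (u s)) ∧
        ‖x‖ ≤ c + θ (∫ s in (0 : ℝ)..1, f s * μ ‖u s‖)) :
    IsLinftyIISS T lam B := by
  obtain ⟨C, η, hC, hη, hgain⟩ :=
    exists_unit_time_gain T lam B f hf hf0 θ hθ c hc μ hμ hbound
  obtain ⟨β, hβ, hT⟩ := hISS.exists_decay
  exact isLinftyIISS_of_unit_time_gain hβ hT hC hη hgain
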